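/- Let $\mathcal H$ be a complex Hilbert space. For a complex sequence $m=(m_n)_{n\in\mathbb N}$ and sequences $\Phi=(\phi_n)$, $\Psi=(\psi_n)$ in $\mathcal H$ let $$M_{m,\Phi,\Psi}f=\sum_n m_n\langle f,\psi_n\rangle\phi_n ,\qquad f\in\mathcal H .$$ The multiplier $M_{m,\Phi,\Psi}$ is well defined if this series converges for every $f\in\mathcal H$ (as a limit of partial sums); it is invertible if it is well defined and has a bounded two-sided inverse $\mathcal H\to\mathcal H$. A sequence is NBA if its norms are bounded above, and NBB if its norms are bounded below by a positive constant; $m$ is SN if it is both. The sequence $\Phi$ is Bessel if $\sum_n|\langle h,\phi_n\rangle|^2\le B\|h\|^2$ for all $h$ and some $B>0$; it is a frame if moreover $A\|h\|^2\le\sum_n|\langle h,\phi_n\rangle|^2$ for all $h$ and some $A>0$; it is a Riesz basis if its linear span is dense and there are $A,B>0$ such that, for every $c\in\ell^2$, $\sum_n c_n\phi_n$ converges and $A\sum_n|c_n|^2\le\|\sum_n c_n\phi_n\|^2\le B\sum_n|c_n|^2$. The canonical dual of a frame $\Phi$ is $\widetilde\Phi=(S_\Phi^{-1}\phi_n)$,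 where $S_\Phi h=\sum_n\langle h,\phi_n\rangle\phi_n$. **Theorem.** Let $\Phi$ be a Riesz basis for $\mathcal H$. Below, "never" and "always" refer to all $m,\Psi$ of the stated type, and "possible" means that, for the given $\Phi$, there are $m,\Psi$ of the stated type, all $m_n$ and $\psi_n$ being nonzero, for which the stated property holds for both $M_{m,\Phi,\Psi}$ and $M_{m,\Psi,\Phi}$. (a) Let $m$ be SN. (a1) If $\Psi$ is non-Bessel, then neither $M_{m,\Phi,\Psi}$ nor $M_{m,\Psi,\Phi}$ is well defined. (a2) If $\Psi$ is Bessel, then $M_{m,\Phi,\Psi}$ is invertible if and only if $\Psi$ is a Riesz basis, and $M_{m,\Psi,\Phi}$ is invertible if and only if $\Psi$ is a Riesz basis. In the case of invertibility, $M_{(1/m_n),\widetilde\Psi,\widetilde\Phi}$ is well defined and $M_{m,\Phi,\Psi}^{-1}=M_{(1/m_n),\widetilde\Psi,\widetilde\Phi}$. (b) Let $m$ be non-NBB and $m\in\ell^\infty$. (b1) If $\Psi$ is NBA and non-Bessel, then each of $M_{m,\Phi,\Psi}$, $M_{m,\Psi,\Phi}$ is never invertible; it is possible that both are well defined, and it is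 possible that both are not well defined. (b2) If $\Psi$ is non-NBA, non-NBB and non-Bessel, the same conclusions as in (b1) hold. (b3) If $\Psi$ is non-NBA, NBB and non-Bessel, all three feasible combinations are possible: both multipliers invertible; both well defined and non-invertible; both not well defined. (b4) If $\Psi$ is Bessel, then both multipliers are always well defined and never invertible. (c) Let $m$ be NBB and $m\notin\ell^\infty$. (c1) If $\Psi$ is non-Bessel or NBB, then both multipliers are never well defined. (c2) If $\Psi$ is non-NBB and Bessel but not a frame, all three feasible combinations listed in (b3) are possible. (c3) If $\Psi$ is a non-NBB frame, then each of the multipliers is never invertible; it is possible that both are well defined, and it is possible that both are not well defined. (d) Let $m$ be non-NBB and $m\notin\ell^\infty$. (d1) If $\Psi$ is NBB, then both multipliers are never well defined. (d2) If $\Psi$ is non-NBB, non-NBA and non-Bessel, all three feasible combinations listed in (b3) are possible. (d3) If $\Psi$ is non-NBB and NBA, then each of the multipliers is never invertible; it is possible that both are well defined, and it is possible that both are not well defined. -/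

import Mathlib

open scoped ENNReal

noncomputable section

/-- Norm-bounded above (NBA): `sup ‖x n‖ < ∞`. -/
def IsNBA {E : Type*} [NormedAddCommGroup E] (x : ℕ → E) : Prop :=
  ∃ b : ℝ, ∀ n, ‖x n‖ ≤ b

/-- Norm-bounded below (NBB): `inf ‖x n‖ > 0`. -/
def IsNBB {E : Type*} [NormedAddCommGroup E] (x : ℕ → E) : Prop :=
  ∃ a : ℝ, 0 < a ∧ ∀ n, a ≤ ‖x n‖

/-- Semi-normalized (SN) symbol: `0 < a ≤ |m n| ≤ b < ∞` for all `n`. -/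
def IsSemiNormalized (m : ℕ → ℂ) : Prop :=
  ∃ a b : ℝ, 0 < a ∧ ∀ n, a ≤ ‖m n‖ ∧ ‖m n‖ ≤ b

section Hilbert

variable {H : Type*} [NormedAddCommGroup H] [InnerProductSpace ℂ H]

/-- Bessel sequence. The inner product `⟨h, φ n⟩`, linear in `h`, is `inner ℂ (Φ n) h`. -/
def IsBesselSeq (Φ : ℕ → H) : Prop :=
  ∃ B : ℝ, 0 < B ∧ ∀ h : H, Summable (fun n => ‖inner ℂ (Φ n) h‖ ^ 2) ∧
    ∑' n, ‖inner ℂ (Φ n) h‖ ^ 2 ≤ B * ‖h‖ ^ 2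

/-- Frame: a Bessel sequence which also satisfies the lower frame condition. -/
def IsFrameSeq (Φ : ℕ → H) : Prop :=
  IsBesselSeq Φ ∧
    ∃ A : ℝ, 0 < A ∧ ∀ h : H, A * ‖h‖ ^ 2 ≤ ∑' n, ‖inner ℂ (Φ n) h‖ ^ 2

/-- Riesz basis: complete in `H`, and for every `c ∈ ℓ²` the series `∑ c n • φ n` converges
(as a limit of partial sums) with `A ∑ |c n|² ≤ ‖∑ c n • φ n‖² ≤ B ∑ |c n|²`. -/
def IsRieszBasis (Φ : ℕ → H) : Prop :=
  (Submodule.span ℂ (Set.range Φ)).topologicalClosure = ⊤ ∧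
    ∃ A B : ℝ, 0 < A ∧ ∀ c : lp (fun _ : ℕ => ℂ) 2, ∃ s : H,
      HasSum (fun n => c n • Φ n) s (SummationFilter.conditional ℕ) ∧
      A * ‖c‖ ^ 2 ≤ ‖s‖ ^ 2 ∧ ‖s‖ ^ 2 ≤ B * ‖c‖ ^ 2

/-- The multiplier `M_{m,Φ,Ψ}` is well defined on `H`: for every `f` the partial sums of
`∑ m n ⟨f, ψ n⟩ φ n` converge. -/
def MultiplierWellDefined (m : ℕ → ℂ) (Φ Ψ : ℕ → H) : Prop :=
  ∀ f : H, Summable (fun n => (m n * inner ℂ (Ψ n) f) • Φ n) (SummationFilter.conditional ℕ)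

/-- The multiplier `M_{m,Φ,Ψ} f = ∑ m n ⟨f, ψ n⟩ φ n` (limit of partial sums); meaningful
when `MultiplierWellDefined m Φ Ψ` holds. -/
def multiplier (m : ℕ → ℂ) (Φ Ψ : ℕ → H) (f : H) : H :=
  ∑'[SummationFilter.conditional ℕ] n, (m n * inner ℂ (Ψ n) f) • Φ n

/-- `M_{m,Φ,Ψ}` is (well defined and) invertible on `H`: it has a bounded two-sided inverse. -/
def MultiplierInvertible (m : ℕ → ℂ) (Φ Ψ : ℕ → H) : Prop :=
  MultiplierWellDefined m Φ Ψ ∧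
    ∃ G : H →L[ℂ] H, Function.LeftInverse G (multiplier m Φ Ψ) ∧
      Function.RightInverse G (multiplier m Φ Ψ)

/-- The frame operator `S h = ∑ ⟨h, φ n⟩ φ n`. -/
def frameOperator (Φ : ℕ → H) : H → H :=
  multiplier (fun _ => 1) Φ Φ

/-- The canonical dual `(S⁻¹ φ n)`; for a frame `S` is bijective, and `Function.invFun` is its
genuine inverse. -/
def canonicalDual (Φ : ℕ → H) (n : ℕ) : H :=
  Function.invFun (frameOperator Φ) (Φ n)

end Hilbert

end

/-! A Riesz basis is `Φ n = V e_n` for an isomorphism `V` from `ℓ²`. If `T` synthesizes `conj (m n)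
• Ψ n`, then `M_{m,Φ,Ψ} = V T*`; if `T` synthesizes `m n • Ψ n`, then `M_{m,Ψ,Φ} = T V*`. Since `V`
and `V*` are bijective, and conjugating weights changes neither the Bessel nor the Riesz property,
everything depends on the one sequence `mΨ`: each multiplier is well defined iff `mΨ` is Bessel and
invertible iff `mΨ` is a Riesz basis (`multiplierWellDefined_left_iff`,
`multiplierInvertible_left_iff` and their right versions).

The negative claims then follow from norms: Bessel sequences are norm-bounded, Riesz bases are also
bounded below, and such bounds on `mΨ` constrain `m` and `Ψ`. Only (c3) needs more: by
`IsFrameSeq.isNBA_of_isRieszBasis_smul`, the lower frame bound, tested on biorthogonal vectors,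
bounds the weight.

Most examples rescale `Φ` by powers of `n + 1`, with separate exponents on even and odd indices, so
every property becomes an integer inequality. The others use a constant sequence, or `Φ` with each
vector taken twice. -/

noncomputable section

/-! ### The model space `ℓ²` and its unit vectors -/

/-- The Hilbert space `ℓ²(ℕ)`. -/
abbrev SeqL2 : Type := lp (fun _ : ℕ => ℂ) 2

/-- The canonical unit vectors of `ℓ²(ℕ)`. -/
def unitVec (n : ℕ) : SeqL2 := lp.single 2 n (1 : ℂ)

lemma inner_unitVec (n : ℕ) (c : SeqL2) : inner ℂ (unitVec n) c = c n := by
  simp [unitVec, lp.inner_single_left]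

lemma norm_unitVec (n : ℕ) : ‖unitVec n‖ = 1 := by
  simp [unitVec, lp.norm_single]

lemma memℓp_two_iff {c : ℕ → ℂ} : Memℓp c 2 ↔ Summable fun n => ‖c n‖ ^ 2 := by
  rw [memℓp_gen_iff (by norm_num)]
  simp

lemma seqL2_summable (c : SeqL2) : Summable fun n => ‖c n‖ ^ 2 :=
  memℓp_two_iff.1 c.2

lemma seqL2_norm_sq (c : SeqL2) : ‖c‖ ^ 2 = ∑' n, ‖c n‖ ^ 2 := by
  have := lp.norm_rpow_eq_tsum (p := 2) (by norm_num) c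
  simpa using this

lemma exists_seqL2 {c : ℕ → ℂ} (hc : Summable fun n => ‖c n‖ ^ 2) : ∃ d : SeqL2, ∀ n, d n = c n :=
  ⟨⟨c, memℓp_two_iff.2 hc⟩, fun _ => rfl⟩

lemma hasSum_unitVec (c : SeqL2) : HasSum (fun n => c n • unitVec n) c := by
  have h := lp.hasSum_single (p := 2) (by norm_num) c
  refine h.congr_fun ?_
  intro n
  simp [unitVec, ← lp.single_smul]

lemma HasSum.conditional {E : Type*} [AddCommMonoid E] [TopologicalSpace E] {f : ℕ → E} {s : E}
    (h : HasSum f s) : HasSum f s (SummationFilter.conditional ℕ) :=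
  h.mono_left (SummationFilter.conditional ℕ).le_atTop

lemma summable_sq_of_norm_le_mul {c d : ℕ → ℂ} {b : ℝ} (hc : Summable fun n => ‖c n‖ ^ 2)
    (h : ∀ n, ‖d n‖ ≤ b * ‖c n‖) : Summable fun n => ‖d n‖ ^ 2 := by
  refine Summable.of_nonneg_of_le (fun _ => by positivity) (fun n => ?_) (hc.mul_left (b ^ 2))
  rw [← mul_pow]
  exact pow_le_pow_left₀ (norm_nonneg _) (h n) 2

/-! ### Synthesis and analysis operators; Bessel sequences -/

section Hilbert

variable {H : Type*} [NormedAddCommGroup H] [InnerProductSpace ℂ H]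

lemma ContinuousLinearMap.hasSum_smul_unitVec {T : SeqL2 →L[ℂ] H} {Φ : ℕ → H}
    (hT : ∀ n, T (unitVec n) = Φ n) (c : SeqL2) : HasSum (fun n => c n • Φ n) (T c) := by
  simpa [hT] using (hasSum_unitVec c).mapL T

/-- Pulling the sum `s` back by `V` and pairing with `e_k` leaves only the term `c k`. So `c` is the
coordinate sequence of `V.symm s`, an element of `ℓ²`. -/
lemma summable_seqL2_of_conditional {V : SeqL2 ≃L[ℂ] H} {Φ : ℕ → H}
    (hV : ∀ n, V (unitVec n) = Φ n) {c : ℕ → ℂ}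
    (hc : Summable (fun n => c n • Φ n) (SummationFilter.conditional ℕ)) :
    Summable fun n => ‖c n‖ ^ 2 := by
  obtain ⟨s, hs⟩ := hc
  have h : V.symm s = fun k => c k := by
    funext k
    have h1 := (hs.mapL (V.symm : H →L[ℂ] SeqL2)).mapL (innerSL ℂ (unitVec k))
    have h2 : HasSum (fun n => innerSL ℂ (unitVec k) ((V.symm : H →L[ℂ] SeqL2) (c n • Φ n))) (c k)
        (SummationFilter.conditional ℕ) := by
      refine HasSum.conditional ?_
      convert hasSum_ite_eq k (c k) using 2 with n
      simp only [← hV, ContinuousLinearEquiv.coe_coe, map_smul, V.symm_apply_apply,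
        innerSL_apply_apply, inner_unitVec, smul_eq_mul]
      by_cases hkn : n = k
      · simp [unitVec, hkn]
      · simp [unitVec, hkn]
    have := h1.unique h2
    simpa [inner_unitVec] using this
  have := seqL2_summable (V.symm s)
  simpa [h] using this

/-- If `∑ c n • Φ n` converges for every `c ∈ ℓ²`, then the sum is a bounded operator of `c`. -/
lemma exists_synthesis_of_conditional {Φ : ℕ → H} {s : SeqL2 → H}
    (h : ∀ c : SeqL2, HasSum (fun n => c n • Φ n) (s c) (SummationFilter.conditional ℕ)) :
    ∃ T : SeqL2 →L[ℂ] H, (∀ n, T (unitVec n) = Φ n) ∧ ∀ c, T c = s c := by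
  let g : ℕ → SeqL2 →L[ℂ] H := fun N =>
    ∑ n ∈ Finset.range N, (innerSL ℂ (unitVec n)).smulRight (Φ n)
  have hlim : Filter.Tendsto (fun N c => g N c) Filter.atTop (nhds s) := by
    rw [tendsto_pi_nhds]
    intro c
    have := h c
    rw [HasSum, SummationFilter.conditional_filter_eq_map_range, Filter.tendsto_map'_iff] at this
    simpa [g, Function.comp_def, inner_unitVec] using this
  -- Banach–Steinhaus: a pointwise limit of bounded operators on a Banach space is bounded.
  let T := continuousLinearMapOfTendsto g hlim
  have hT : ∀ c, T c = s c := fun c => rfl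
  refine ⟨T, fun n => ?_, hT⟩
  rw [hT]
  refine (h (unitVec n)).unique (HasSum.conditional ?_)
  convert hasSum_ite_eq n (Φ n) using 2 with k
  by_cases hkn : k = n
  · simp [unitVec, hkn]
  · simp [unitVec, hkn]

variable [CompleteSpace H]

lemma adjoint_apply_eq_inner {T : SeqL2 →L[ℂ] H} {Φ : ℕ → H}
    (hT : ∀ n, T (unitVec n) = Φ n) (h : H) (n : ℕ) :
    (ContinuousLinearMap.adjoint T h : SeqL2) n = inner ℂ (Φ n) h := by
  rw [← inner_unitVec, ContinuousLinearMap.adjoint_inner_right, hT]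

/-- The analysis map of a sequence all of whose analysis coefficients are square summable is
bounded, by the closed graph theorem. -/
lemma exists_analysis {Φ : ℕ → H} (hΦ : ∀ h, Summable fun n => ‖inner ℂ (Φ n) h‖ ^ 2) :
    ∃ U : H →L[ℂ] SeqL2, ∀ h n, U h n = inner ℂ (Φ n) h := by
  let g : H →ₗ[ℂ] SeqL2 :=
    { toFun := fun h => ⟨fun n => inner ℂ (Φ n) h, memℓp_two_iff.2 (hΦ h)⟩
      map_add' := fun x y => by ext n; exact inner_add_right _ _ _
      map_smul' := fun a x => by ext n; exact inner_smul_right _ _ _ }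
  have hg : ∀ h n, g h n = inner ℂ (Φ n) h := fun _ _ => rfl
  refine ⟨ContinuousLinearMap.ofSeqClosedGraph (g := g) fun u x y hu hy => ?_, fun h n => rfl⟩
  ext n
  have h1 : Filter.Tendsto (fun k => inner ℂ (unitVec n) (g (u k))) Filter.atTop
      (nhds (inner ℂ (unitVec n) y)) := (tendsto_const_nhds).inner hy
  have h2 : Filter.Tendsto (fun k => inner ℂ (Φ n) (u k)) Filter.atTop
      (nhds (inner ℂ (Φ n) x)) := (tendsto_const_nhds).inner hu
  simp only [inner_unitVec, hg] at h1
  rw [hg]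
  exact tendsto_nhds_unique h1 h2

lemma IsBesselSeq.of_synthesis {Φ : ℕ → H} (T : SeqL2 →L[ℂ] H)
    (hT : ∀ n, T (unitVec n) = Φ n) : IsBesselSeq Φ := by
  -- The `+ 1` keeps the Bessel bound positive even when `T = 0`.
  refine ⟨‖T‖ ^ 2 + 1, by positivity, fun h => ?_⟩
  simp only [← adjoint_apply_eq_inner hT]
  refine ⟨seqL2_summable _, ?_⟩
  rw [← seqL2_norm_sq]
  have h1 := (ContinuousLinearMap.adjoint T).le_opNorm h
  rw [LinearIsometryEquiv.norm_map] at h1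
  have h2 := pow_le_pow_left₀ (norm_nonneg _) h1 2
  nlinarith [sq_nonneg ‖h‖]

/-- The synthesis operator is the adjoint of the analysis operator, whose boundedness is already
known. -/
lemma exists_synthesis {Φ : ℕ → H} (hΦ : ∀ h, Summable fun n => ‖inner ℂ (Φ n) h‖ ^ 2) :
    ∃ T : SeqL2 →L[ℂ] H, ∀ n, T (unitVec n) = Φ n := by
  obtain ⟨U, hU⟩ := exists_analysis hΦ
  refine ⟨ContinuousLinearMap.adjoint U, fun n => ext_inner_right ℂ fun h => ?_⟩
  rw [ContinuousLinearMap.adjoint_inner_left, inner_unitVec, hU]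

lemma isBesselSeq_iff_summable {Φ : ℕ → H} :
    IsBesselSeq Φ ↔ ∀ h, Summable fun n => ‖inner ℂ (Φ n) h‖ ^ 2 := by
  refine ⟨fun ⟨B, _, h⟩ f => (h f).1, fun h => ?_⟩
  obtain ⟨T, hT⟩ := exists_synthesis h
  exact .of_synthesis T hT

lemma isBesselSeq_iff_exists_synthesis {Φ : ℕ → H} :
    IsBesselSeq Φ ↔ ∃ T : SeqL2 →L[ℂ] H, ∀ n, T (unitVec n) = Φ n :=
  ⟨fun h => exists_synthesis (isBesselSeq_iff_summable.1 h), fun ⟨T, hT⟩ => .of_synthesis T hT⟩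

/-! ### Riesz bases as isomorphic images of the unit vectors -/

/-- A Riesz basis is the image of the canonical basis of `ℓ²` under an isomorphism. -/
lemma isRieszBasis_iff_exists_equiv {Φ : ℕ → H} :
    IsRieszBasis Φ ↔ ∃ V : SeqL2 ≃L[ℂ] H, ∀ n, V (unitVec n) = Φ n := by
  constructor
  · rintro ⟨hdense, A, B, hA, h⟩
    choose s hs using h
    obtain ⟨T, hT, hTs⟩ := exists_synthesis_of_conditional fun c => (hs c).1
    -- The lower Riesz bound makes `T` injective with closed range; completeness of `Φ` makes that
    -- range dense, hence everything.
    have hbelow : ∀ c, ‖c‖ ≤ (Real.toNNReal (√A)⁻¹ : ℝ) * ‖T c‖ := by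
      intro c
      have h1 := (hs c).2.1
      rw [Real.coe_toNNReal _ (by positivity), inv_mul_eq_div, le_div_iff₀ (by positivity)]
      refine le_of_sq_le_sq ?_ (norm_nonneg _)
      rw [mul_pow, Real.sq_sqrt hA.le, hTs]
      linarith
    have hanti := ContinuousLinearMap.antilipschitz_of_bound T hbelow
    have hclosed : IsClosed (Set.range T) := hanti.isClosed_range T.uniformContinuous
    have hspan : Submodule.span ℂ (Set.range Φ) ≤ T.range := by
      rw [Submodule.span_le]
      rintro _ ⟨n, rfl⟩
      exact ⟨unitVec n, hT n⟩
    have hrange : T.range = ⊤ := by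
      rw [eq_top_iff, ← hdense]
      exact Submodule.topologicalClosure_minimal _ hspan (by rwa [LinearMap.coe_range])
    have hker : T.ker = ⊥ := LinearMap.ker_eq_bot.2 hanti.injective
    exact ⟨ContinuousLinearEquiv.ofBijective T hker hrange, hT⟩
  · rintro ⟨V, hV⟩
    refine ⟨?_, (‖(V.symm : H →L[ℂ] SeqL2)‖ ^ 2 + 1)⁻¹, ‖(V : SeqL2 →L[ℂ] H)‖ ^ 2, by positivity,
      fun c => ⟨V c, ?_, ?_, ?_⟩⟩
    · rw [eq_top_iff]
      intro x _
      have hsum := ContinuousLinearMap.hasSum_smul_unitVec (T := (V : SeqL2 →L[ℂ] H)) hV (V.symm x)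
      simp only [ContinuousLinearEquiv.coe_coe, V.apply_symm_apply] at hsum
      refine mem_closure_of_tendsto hsum (Filter.Eventually.of_forall fun s => ?_)
      exact Submodule.sum_mem _ fun n _ =>
        Submodule.smul_mem _ _ (Submodule.subset_span ⟨n, rfl⟩)
    · exact (ContinuousLinearMap.hasSum_smul_unitVec (T := (V : SeqL2 →L[ℂ] H)) hV c).conditional
    · have h1 := (V.symm : H →L[ℂ] SeqL2).le_opNorm (V c)
      simp only [ContinuousLinearEquiv.coe_coe, V.symm_apply_apply] at h1
      have h2 := pow_le_pow_left₀ (norm_nonneg _) h1 2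
      rw [inv_mul_le_iff₀ (by positivity)]
      nlinarith [sq_nonneg ‖V c‖]
    · have h1 := (V : SeqL2 →L[ℂ] H).le_opNorm c
      have h2 := pow_le_pow_left₀ (norm_nonneg _) h1 2
      rwa [mul_pow] at h2

lemma ContinuousLinearMap.adjoint_bijective_of_bijective {E F : Type*} [NormedAddCommGroup E]
    [InnerProductSpace ℂ E] [CompleteSpace E] [NormedAddCommGroup F] [InnerProductSpace ℂ F]
    [CompleteSpace F] {T : E →L[ℂ] F} (hT : Function.Bijective T) :
    Function.Bijective (ContinuousLinearMap.adjoint T) := by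
  let e := ContinuousLinearEquiv.ofBijective T (LinearMap.ker_eq_bot.2 hT.1)
    (LinearMap.range_eq_top.2 hT.2)
  let G : F →L[ℂ] E := e.symm
  have h1 : ∀ x, G (T x) = x := e.symm_apply_apply
  have h2 : ∀ x, T (G x) = x := e.apply_symm_apply
  refine Function.bijective_iff_has_inverse.2 ⟨ContinuousLinearMap.adjoint G, fun x => ?_,
    fun x => ?_⟩
  · refine ext_inner_right ℂ fun y => ?_
    rw [ContinuousLinearMap.adjoint_inner_left, ContinuousLinearMap.adjoint_inner_left, h2]
  · refine ext_inner_right ℂ fun y => ?_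
    rw [ContinuousLinearMap.adjoint_inner_left, ContinuousLinearMap.adjoint_inner_left, h1]

lemma isRieszBasis_of_bijective {Φ : ℕ → H} {T : SeqL2 →L[ℂ] H} (hT : ∀ n, T (unitVec n) = Φ n)
    (hb : Function.Bijective T) : IsRieszBasis Φ :=
  isRieszBasis_iff_exists_equiv.2 ⟨ContinuousLinearEquiv.ofBijective T
    (LinearMap.ker_eq_bot.2 hb.1) (LinearMap.range_eq_top.2 hb.2), hT⟩

lemma isRieszBasis_of_bijective_adjoint {Φ : ℕ → H} {T : SeqL2 →L[ℂ] H}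
    (hT : ∀ n, T (unitVec n) = Φ n)
    (hb : Function.Bijective (ContinuousLinearMap.adjoint T)) : IsRieszBasis Φ := by
  refine isRieszBasis_of_bijective hT ?_
  simpa using ContinuousLinearMap.adjoint_bijective_of_bijective hb

lemma IsRieszBasis.exists_synthesis {Φ : ℕ → H} (hΦ : IsRieszBasis Φ) :
    ∃ V : SeqL2 →L[ℂ] H, (∀ n, V (unitVec n) = Φ n) ∧ Function.Bijective V ∧
      Function.Bijective (ContinuousLinearMap.adjoint V) := by
  obtain ⟨V, hV⟩ := isRieszBasis_iff_exists_equiv.1 hΦ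
  exact ⟨V, hV, V.bijective, ContinuousLinearMap.adjoint_bijective_of_bijective V.bijective⟩

lemma IsRieszBasis.isBesselSeq {Φ : ℕ → H} (hΦ : IsRieszBasis Φ) : IsBesselSeq Φ := by
  obtain ⟨V, hV, -⟩ := hΦ.exists_synthesis
  exact .of_synthesis V hV

/-- Riesz bases are the Bessel sequences whose moment problem is uniquely solvable in `ℓ²`. -/
lemma isRieszBasis_iff_moment {Φ : ℕ → H} :
    IsRieszBasis Φ ↔ (∀ h, Summable fun n => ‖inner ℂ (Φ n) h‖ ^ 2) ∧
      ∀ c : SeqL2, ∃! h : H, ∀ n, inner ℂ (Φ n) h = c n := by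
  -- The moment problem is the equation `T* h = c`, so unique solvability is bijectivity of `T*`.
  have key : ∀ {T : SeqL2 →L[ℂ] H}, (∀ n, T (unitVec n) = Φ n) →
      ∀ (c : SeqL2) (h : H), (∀ n, inner ℂ (Φ n) h = c n) ↔
        ContinuousLinearMap.adjoint T h = c := by
    intro T hT c h
    simp only [← adjoint_apply_eq_inner hT]
    exact ⟨fun h => by ext n; exact h n, fun h n => by rw [h]⟩
  constructor
  · intro hΦ
    refine ⟨isBesselSeq_iff_summable.1 hΦ.isBesselSeq, fun c => ?_⟩
    obtain ⟨V, hV, -, hb⟩ := hΦ.exists_synthesis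
    simp only [key hV]
    exact hb.existsUnique c
  · rintro ⟨h1, h2⟩
    obtain ⟨T, hT⟩ := _root_.exists_synthesis h1
    refine isRieszBasis_of_bijective_adjoint hT ?_
    simp only [key hT] at h2
    exact Function.bijective_iff_existsUnique _ |>.2 h2

end Hilbert

/-! ### Multipliers with a Riesz basis in one slot -/

section Hilbert

variable {H : Type*} [NormedAddCommGroup H] [InnerProductSpace ℂ H]

lemma norm_inner_smul_left (a : ℂ) (x y : H) : ‖inner ℂ (a • x) y‖ = ‖a * inner ℂ x y‖ := by
  rw [inner_smul_left, norm_mul, norm_mul, RCLike.norm_conj]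

lemma multiplier_eq_of_hasSum {m : ℕ → ℂ} {Φ Ψ : ℕ → H} {f s : H}
    (h : HasSum (fun n => (m n * inner ℂ (Ψ n) f) • Φ n) s) : multiplier m Φ Ψ f = s :=
  h.conditional.tsum_eq

lemma multiplier_eq_apply {m : ℕ → ℂ} {Φ Ψ : ℕ → H} {T : SeqL2 →L[ℂ] H}
    (hT : ∀ n, T (unitVec n) = Φ n) {f : H} {c : SeqL2} (hc : ∀ n, c n = m n * inner ℂ (Ψ n) f) :
    multiplier m Φ Ψ f = T c := by
  refine multiplier_eq_of_hasSum ?_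
  simpa only [hc] using T.hasSum_smul_unitVec hT c

variable [CompleteSpace H]

lemma IsBesselSeq.of_norm_le {c : ℕ → ℂ} {Φ Ψ : ℕ → H} {b : ℝ} (hΦ : IsBesselSeq Φ)
    (hΨ : ∀ n, Ψ n = c n • Φ n) (hc : ∀ n, ‖c n‖ ≤ b) : IsBesselSeq Ψ := by
  rw [isBesselSeq_iff_summable] at hΦ ⊢
  intro h
  refine summable_sq_of_norm_le_mul (hΦ h) (b := b) fun n => ?_
  rw [hΨ, norm_inner_smul_left, norm_mul]
  exact mul_le_mul_of_nonneg_right (hc n) (norm_nonneg _)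

/-- Semi-normalized rescalings of Riesz bases are Riesz bases. -/
lemma IsRieszBasis.smul {c : ℕ → ℂ} {Φ : ℕ → H} (hΦ : IsRieszBasis Φ)
    (hc : IsSemiNormalized c) : IsRieszBasis fun n => c n • Φ n := by
  obtain ⟨a, b, ha, hab⟩ := hc
  have hc0 : ∀ n, c n ≠ 0 := fun n => norm_pos_iff.1 (ha.trans_le (hab n).1)
  have hB : IsBesselSeq fun n => c n • Φ n :=
    hΦ.isBesselSeq.of_norm_le (fun _ => rfl) fun n => (hab n).2
  rw [isRieszBasis_iff_moment] at hΦ ⊢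
  refine ⟨isBesselSeq_iff_summable.1 hB, fun d => ?_⟩
  -- Rescaling by `c` multiplies the moments by `conj (c n)`; dividing the data by it stays in `ℓ²`
  -- because `c` is bounded below.
  obtain ⟨d', hd'⟩ := exists_seqL2 (c := fun n => d n / starRingEnd ℂ (c n))
    (summable_sq_of_norm_le_mul (seqL2_summable d) (b := a⁻¹) fun n => by
      rw [norm_div, RCLike.norm_conj, div_eq_inv_mul]
      exact mul_le_mul_of_nonneg_right (inv_anti₀ ha (hab n).1) (norm_nonneg _))
  have key : ∀ h, (∀ n, inner ℂ (c n • Φ n) h = d n) ↔ ∀ n, inner ℂ (Φ n) h = d' n := by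
    intro h
    refine forall_congr' fun n => ?_
    have : starRingEnd ℂ (c n) ≠ 0 := by simpa using hc0 n
    rw [inner_smul_left, hd', eq_div_iff this, mul_comm]
  simp only [key]
  exact hΦ.2 d'

lemma IsRieszBasis.of_norm_eq {c d : ℕ → ℂ} {Φ : ℕ → H} (hcd : ∀ n, ‖c n‖ = ‖d n‖)
    (h : IsRieszBasis fun n => d n • Φ n) : IsRieszBasis fun n => c n • Φ n := by
  -- The unimodular ratio of the weights. The value 1 where `d n = 0` keeps `u` semi-normalized, and
  -- is harmless since `c n = 0` there too.
  let u : ℕ → ℂ := fun n => if d n = 0 then 1 else c n / d n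
  have hu : ∀ n, ‖u n‖ = 1 := by
    intro n
    by_cases hd : d n = 0
    · simp [u, hd]
    · have : ‖d n‖ ≠ 0 := by simpa using hd
      simp [u, hd, hcd, this]
  have huc : ∀ n, u n * d n = c n := by
    intro n
    by_cases hd : d n = 0
    · have := hcd n
      simp only [hd, norm_zero, norm_eq_zero] at this
      simp [hd, this]
    · simp [u, hd]
  have := h.smul (c := u) ⟨1, 1, one_pos, fun n => by simp [hu]⟩
  simpa only [smul_smul, huc] using this

lemma isRieszBasis_congr_norm {c d : ℕ → ℂ} {Φ : ℕ → H} (hcd : ∀ n, ‖c n‖ = ‖d n‖) :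
    (IsRieszBasis fun n => c n • Φ n) ↔ IsRieszBasis fun n => d n • Φ n :=
  ⟨.of_norm_eq fun n => (hcd n).symm, .of_norm_eq hcd⟩

lemma isBesselSeq_smul_iff {m : ℕ → ℂ} {Ψ : ℕ → H} :
    (IsBesselSeq fun n => m n • Ψ n) ↔ ∀ f, Summable fun n => ‖m n * inner ℂ (Ψ n) f‖ ^ 2 := by
  simp only [isBesselSeq_iff_summable, norm_inner_smul_left]

lemma IsBesselSeq.conj_smul {m : ℕ → ℂ} {Ψ : ℕ → H} (h : IsBesselSeq fun n => m n • Ψ n) :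
    IsBesselSeq fun n => starRingEnd ℂ (m n) • Ψ n := by
  rw [isBesselSeq_smul_iff] at h ⊢
  simpa using h

/-- A series along a Riesz basis converges exactly when its coefficients are in `ℓ²`. -/
lemma multiplierWellDefined_left_iff {m : ℕ → ℂ} {Φ Ψ : ℕ → H} (hΦ : IsRieszBasis Φ) :
    MultiplierWellDefined m Φ Ψ ↔ IsBesselSeq fun n => m n • Ψ n := by
  obtain ⟨V, hV⟩ := isRieszBasis_iff_exists_equiv.1 hΦ
  rw [isBesselSeq_smul_iff]
  refine forall_congr' fun f => ⟨summable_seqL2_of_conditional hV, fun h => ?_⟩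
  obtain ⟨c, hc⟩ := exists_seqL2 h
  have := ContinuousLinearMap.hasSum_smul_unitVec (T := (V : SeqL2 →L[ℂ] H)) hV c
  simp only [hc] at this
  exact this.conditional.summable

/-- The coefficients of `f` against `Φ` run through all of `ℓ²`, so convergence for every `f` is
convergence of `∑ c n • m n • Ψ n` for every `c ∈ ℓ²`. -/
lemma multiplierWellDefined_right_iff {m : ℕ → ℂ} {Φ Ψ : ℕ → H} (hΦ : IsRieszBasis Φ) :
    MultiplierWellDefined m Ψ Φ ↔ IsBesselSeq fun n => m n • Ψ n := by
  obtain ⟨V, hV, -, hb⟩ := hΦ.exists_synthesis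
  have hterm : ∀ f n, (m n * inner ℂ (Φ n) f) • Ψ n =
      (ContinuousLinearMap.adjoint V f : SeqL2) n • m n • Ψ n := by
    intro f n
    rw [adjoint_apply_eq_inner hV, smul_smul, mul_comm]
  constructor
  · intro h
    have h' : ∀ c : SeqL2, ∃ s, HasSum (fun n => c n • m n • Ψ n) s
        (SummationFilter.conditional ℕ) := by
      intro c
      obtain ⟨f, rfl⟩ := hb.2 c
      obtain ⟨s, hs⟩ := h f
      exact ⟨s, by simpa only [hterm] using hs⟩
    choose s hs using h'
    obtain ⟨T, hT, -⟩ := exists_synthesis_of_conditional hs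
    exact .of_synthesis T hT
  · intro h f
    obtain ⟨T, hT⟩ := isBesselSeq_iff_exists_synthesis.1 h
    have := T.hasSum_smul_unitVec hT (ContinuousLinearMap.adjoint V f)
    simp only [← hterm] at this
    exact this.conditional.summable

lemma multiplierInvertible_iff_bijective {m : ℕ → ℂ} {Φ Ψ : ℕ → H} {L : H →L[ℂ] H}
    (hw : MultiplierWellDefined m Φ Ψ) (hL : ∀ f, multiplier m Φ Ψ f = L f) :
    MultiplierInvertible m Φ Ψ ↔ Function.Bijective L := by
  have hL' : multiplier m Φ Ψ = L := funext hL
  constructor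
  · rintro ⟨-, G, h1, h2⟩
    rw [hL'] at h1 h2
    exact ⟨h1.injective, h2.surjective⟩
  · intro hb
    let e := ContinuousLinearEquiv.ofBijective L (LinearMap.ker_eq_bot.2 hb.1)
      (LinearMap.range_eq_top.2 hb.2)
    refine ⟨hw, e.symm, ?_, ?_⟩
    · rw [hL']; exact e.symm_apply_apply
    · rw [hL']; exact e.apply_symm_apply

lemma multiplierInvertible_left_iff {m : ℕ → ℂ} {Φ Ψ : ℕ → H} (hΦ : IsRieszBasis Φ) :
    MultiplierInvertible m Φ Ψ ↔ IsRieszBasis fun n => m n • Ψ n := by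
  obtain ⟨V, hV, hVb, -⟩ := hΦ.exists_synthesis
  have key : ∀ {T : SeqL2 →L[ℂ] H}, MultiplierWellDefined m Φ Ψ →
      (∀ n, T (unitVec n) = starRingEnd ℂ (m n) • Ψ n) →
      (MultiplierInvertible m Φ Ψ ↔ Function.Bijective (ContinuousLinearMap.adjoint T)) := by
    intro T hw hT
    -- The factorization `M = V T*`. The weight of `T` is conjugated because `T*` conjugates it back
    -- to `m n`.
    rw [multiplierInvertible_iff_bijective (L := V ∘L ContinuousLinearMap.adjoint T) hw,
      ContinuousLinearMap.coe_comp, Function.Bijective.of_comp_iff' hVb]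
    intro f
    refine multiplier_eq_apply hV (c := ContinuousLinearMap.adjoint T f) fun n => ?_
    rw [adjoint_apply_eq_inner hT, inner_smul_left, Complex.conj_conj]
  rw [isRieszBasis_congr_norm (d := fun n => starRingEnd ℂ (m n)) (fun n => by simp)]
  constructor
  · intro h
    obtain ⟨T, hT⟩ := isBesselSeq_iff_exists_synthesis.1
      ((multiplierWellDefined_left_iff hΦ).1 h.1).conj_smul
    exact isRieszBasis_of_bijective_adjoint hT ((key h.1 hT).1 h)
  · intro h
    have hw : MultiplierWellDefined m Φ Ψ :=
      (multiplierWellDefined_left_iff hΦ).2 (by simpa using h.isBesselSeq.conj_smul)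
    obtain ⟨T, hT, -, hb⟩ := h.exists_synthesis
    exact (key hw hT).2 hb

lemma multiplierInvertible_right_iff {m : ℕ → ℂ} {Φ Ψ : ℕ → H} (hΦ : IsRieszBasis Φ) :
    MultiplierInvertible m Ψ Φ ↔ IsRieszBasis fun n => m n • Ψ n := by
  obtain ⟨V, hV, -, hVb⟩ := hΦ.exists_synthesis
  have key : ∀ {T : SeqL2 →L[ℂ] H}, MultiplierWellDefined m Ψ Φ →
      (∀ n, T (unitVec n) = m n • Ψ n) →
      (MultiplierInvertible m Ψ Φ ↔ Function.Bijective T) := by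
    intro T hw hT
    -- The factorization `M = T V*`.
    rw [multiplierInvertible_iff_bijective (L := T ∘L ContinuousLinearMap.adjoint V) hw,
      ContinuousLinearMap.coe_comp, Function.Bijective.of_comp_iff _ hVb]
    intro f
    refine multiplier_eq_of_hasSum ?_
    have := T.hasSum_smul_unitVec hT (ContinuousLinearMap.adjoint V f)
    simpa only [adjoint_apply_eq_inner hV, smul_smul, mul_comm, ContinuousLinearMap.comp_apply]
      using this
  constructor
  · intro h
    obtain ⟨T, hT⟩ := isBesselSeq_iff_exists_synthesis.1
      ((multiplierWellDefined_right_iff hΦ).1 h.1)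
    exact isRieszBasis_of_bijective hT ((key h.1 hT).1 h)
  · intro h
    obtain ⟨T, hT, hb, -⟩ := h.exists_synthesis
    exact (key ((multiplierWellDefined_right_iff hΦ).2 h.isBesselSeq) hT).2 hb

/-! ### Canonical duals and the formula for the inverse -/

/-- The canonical dual of a Riesz basis is the image of the canonical basis of `ℓ²` under the
inverse of the analysis operator. -/
lemma IsRieszBasis.exists_canonicalDual {Φ : ℕ → H} (hΦ : IsRieszBasis Φ) :
    ∃ V R : SeqL2 →L[ℂ] H, (∀ n, V (unitVec n) = Φ n) ∧
      (∀ n, R (unitVec n) = canonicalDual Φ n) ∧ Function.Bijective R ∧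
      (∀ h, R (ContinuousLinearMap.adjoint V h) = h) ∧
      (∀ c, ContinuousLinearMap.adjoint V (R c) = c) ∧
      (∀ h, V (ContinuousLinearMap.adjoint R h) = h) := by
  obtain ⟨V, hV, hVb, hb⟩ := hΦ.exists_synthesis
  let e := ContinuousLinearEquiv.ofBijective (ContinuousLinearMap.adjoint V)
    (LinearMap.ker_eq_bot.2 hb.1) (LinearMap.range_eq_top.2 hb.2)
  let R : SeqL2 →L[ℂ] H := e.symm
  have h1 : ∀ h, R (ContinuousLinearMap.adjoint V h) = h := e.symm_apply_apply
  have h2 : ∀ c, ContinuousLinearMap.adjoint V (R c) = c := e.apply_symm_apply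
  -- From `S = V V*` and `Φ n = V e_n`, the dual vector `S⁻¹ (Φ n)` is `(V*)⁻¹ e_n`.
  have hS : frameOperator Φ = fun h => V (ContinuousLinearMap.adjoint V h) := by
    funext h
    refine multiplier_eq_apply hV fun n => ?_
    rw [adjoint_apply_eq_inner hV, one_mul]
  have hSinj : Function.Injective (frameOperator Φ) := by
    rw [hS]
    exact hVb.1.comp hb.1
  refine ⟨V, R, hV, fun n => ?_, e.symm.bijective, h1, h2, fun h => ?_⟩
  · have : frameOperator Φ (R (unitVec n)) = Φ n := by rw [hS]; simp only [h2, hV]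
    rw [canonicalDual, ← this, Function.leftInverse_invFun hSinj]
  · refine ext_inner_right ℂ fun y => ?_
    rw [← ContinuousLinearMap.adjoint_inner_right, ContinuousLinearMap.adjoint_inner_left, h1]

/-- By biorthogonality, pairing `M f` with the dual of `Φ` returns `m n * inner ℂ (Ψ n) f`. Dividing
by `m n` leaves the analysis coefficients of `f`, from which the dual of `Ψ` rebuilds `f`. The other
composition is symmetric. -/
lemma multiplier_inverse {m : ℕ → ℂ} {Φ Ψ : ℕ → H} (hm : IsSemiNormalized m)
    (hΦ : IsRieszBasis Φ) (hΨ : IsRieszBasis Ψ) :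
    MultiplierWellDefined (fun n => 1 / m n) (canonicalDual Ψ) (canonicalDual Φ) ∧
      Function.LeftInverse (multiplier (fun n => 1 / m n) (canonicalDual Ψ) (canonicalDual Φ))
        (multiplier m Φ Ψ) ∧
      Function.RightInverse (multiplier (fun n => 1 / m n) (canonicalDual Ψ) (canonicalDual Φ))
        (multiplier m Φ Ψ) := by
  obtain ⟨a, b, ha, hab⟩ := hm
  have hm0 : ∀ n, m n ≠ 0 := fun n => norm_pos_iff.1 (ha.trans_le (hab n).1)
  have hinv : ∀ n, ‖1 / m n‖ ≤ 1 / a := fun n => by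
    rw [norm_div, norm_one]
    exact one_div_le_one_div_of_le ha (hab n).1
  obtain ⟨V, R, hV, hR, hRb, hRV, hVR, hVR'⟩ := hΦ.exists_canonicalDual
  obtain ⟨W, Q, hW, hQ, hQb, hQW, hWQ, -⟩ := hΨ.exists_canonicalDual
  have hdual : ∀ h n, inner ℂ (canonicalDual Φ n) h = (ContinuousLinearMap.adjoint R h) n :=
    fun h n => (adjoint_apply_eq_inner hR h n).symm
  refine ⟨?_, fun f => ?_, fun f => ?_⟩
  · rw [multiplierWellDefined_left_iff (isRieszBasis_of_bijective hQ hQb)]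
    exact (isRieszBasis_of_bijective hR hRb).isBesselSeq.of_norm_le (fun _ => rfl) hinv
  · obtain ⟨c, hc⟩ := exists_seqL2 (c := fun n => m n * inner ℂ (Ψ n) f)
      (summable_sq_of_norm_le_mul (isBesselSeq_iff_summable.1 hΨ.isBesselSeq f) (b := b)
        fun n => by
          rw [norm_mul]
          exact mul_le_mul_of_nonneg_right (hab n).2 (norm_nonneg _))
    rw [multiplier_eq_apply hV hc,
      multiplier_eq_apply hQ (c := ContinuousLinearMap.adjoint W f) fun n => ?_, hQW]
    -- `V R* = 1` gives `R* V = 1` because `R*` is surjective.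
    have hadj : ContinuousLinearMap.adjoint R (V c) = c := by
      obtain ⟨y, rfl⟩ := (ContinuousLinearMap.adjoint_bijective_of_bijective hRb).2 c
      rw [hVR']
    rw [hdual, hadj, hc, adjoint_apply_eq_inner hW, one_div, inv_mul_cancel_left₀ (hm0 n)]
  · obtain ⟨c, hc⟩ := exists_seqL2 (c := fun n => 1 / m n * inner ℂ (canonicalDual Φ n) f)
      (summable_sq_of_norm_le_mul (isBesselSeq_iff_summable.1
        (isRieszBasis_of_bijective hR hRb).isBesselSeq f) (b := 1 / a)
        fun n => by
          rw [norm_mul]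
          exact mul_le_mul_of_nonneg_right (hinv n) (norm_nonneg _))
    rw [multiplier_eq_apply hQ hc,
      multiplier_eq_apply hV (c := ContinuousLinearMap.adjoint R f) fun n => ?_, hVR']
    rw [← adjoint_apply_eq_inner hW, hWQ, hc, hdual, one_div, mul_inv_cancel_left₀ (hm0 n)]

end Hilbert

/-! ### Norm bounds and their behaviour under weights -/

lemma memℓp_top_iff {m : ℕ → ℂ} : Memℓp m ∞ ↔ IsNBA m := by
  rw [memℓp_infty_iff]
  refine exists_congr fun b => ?_
  simp [mem_upperBounds]

lemma IsNBA.of_norm_le_mul {E F : Type*} [NormedAddCommGroup E] [NormedAddCommGroup F]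
    {x : ℕ → E} {y : ℕ → F} (hy : IsNBA y) {b : ℝ} (h : ∀ n, ‖x n‖ ≤ b * ‖y n‖) : IsNBA x := by
  obtain ⟨c, hc⟩ := hy
  refine ⟨|b| * c, fun n => (h n).trans ?_⟩
  exact mul_le_mul (le_abs_self b) (hc n) (norm_nonneg _) (abs_nonneg _)

lemma IsNBB.inv_smul {E : Type*} [NormedAddCommGroup E] [NormedSpace ℂ E] {m : ℕ → ℂ} {x : ℕ → E}
    (hm : IsNBB m) : ∃ b : ℝ, ∀ n, ‖(m n)⁻¹‖ ≤ b ∧ x n = (m n)⁻¹ • m n • x n := by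
  obtain ⟨a, ha, hm⟩ := hm
  refine ⟨a⁻¹, fun n => ⟨?_, ?_⟩⟩
  · rw [norm_inv]; exact inv_anti₀ ha (hm n)
  · rw [inv_smul_smul₀ (norm_pos_iff.1 (ha.trans_le (hm n)))]

/-- If `m • x` is bounded below and `x` is bounded, then `m` is bounded below. -/
lemma IsNBB.of_smul_right {E : Type*} [NormedAddCommGroup E] [NormedSpace ℂ E] {m : ℕ → ℂ}
    {x : ℕ → E} (h : IsNBB fun n => m n • x n) (hx : IsNBA x) : IsNBB m := by
  obtain ⟨a, ha, h⟩ := h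
  obtain ⟨b, hb⟩ := hx
  refine ⟨a / (|b| + 1), by positivity, fun n => ?_⟩
  rw [div_le_iff₀ (by positivity)]
  have h1 := h n
  rw [norm_smul] at h1
  have h2 : ‖x n‖ ≤ |b| + 1 := by linarith [hb n, le_abs_self b]
  exact h1.trans (mul_le_mul_of_nonneg_left h2 (norm_nonneg _))

/-- If `m • x` is bounded below and `m` is bounded, then `x` is bounded below. -/
lemma IsNBB.of_smul_left {E : Type*} [NormedAddCommGroup E] [NormedSpace ℂ E] {m : ℕ → ℂ}
    {x : ℕ → E} (h : IsNBB fun n => m n • x n) (hm : IsNBA m) : IsNBB x := by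
  obtain ⟨a, ha, h⟩ := h
  obtain ⟨b, hb⟩ := hm
  refine ⟨a / (|b| + 1), by positivity, fun n => ?_⟩
  rw [div_le_iff₀ (by positivity)]
  have h1 := h n
  rw [norm_smul, mul_comm] at h1
  have h2 : ‖m n‖ ≤ |b| + 1 := by linarith [hb n, le_abs_self b]
  exact h1.trans (mul_le_mul_of_nonneg_left h2 (norm_nonneg _))

/-- If `m • x` is bounded and `x` is bounded below, then `m` is bounded. -/
lemma IsNBA.of_smul_right {E : Type*} [NormedAddCommGroup E] [NormedSpace ℂ E] {m : ℕ → ℂ}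
    {x : ℕ → E} (h : IsNBA fun n => m n • x n) (hx : IsNBB x) : IsNBA m := by
  obtain ⟨a, ha, hx⟩ := hx
  refine h.of_norm_le_mul (b := a⁻¹) fun n => ?_
  rw [inv_mul_eq_div, le_div_iff₀ ha, norm_smul]
  exact mul_le_mul_of_nonneg_left (hx n) (norm_nonneg _)

section Hilbert

variable {H : Type*} [NormedAddCommGroup H] [InnerProductSpace ℂ H] [CompleteSpace H]

lemma IsBesselSeq.isNBA {Φ : ℕ → H} (hΦ : IsBesselSeq Φ) : IsNBA Φ := by
  obtain ⟨T, hT⟩ := isBesselSeq_iff_exists_synthesis.1 hΦ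
  refine ⟨‖T‖, fun n => ?_⟩
  have := T.le_opNorm (unitVec n)
  rwa [hT, norm_unitVec, mul_one] at this

lemma IsRieszBasis.isNBA {Φ : ℕ → H} (hΦ : IsRieszBasis Φ) : IsNBA Φ := hΦ.isBesselSeq.isNBA

lemma IsRieszBasis.isNBB {Φ : ℕ → H} (hΦ : IsRieszBasis Φ) : IsNBB Φ := by
  obtain ⟨V, hV⟩ := isRieszBasis_iff_exists_equiv.1 hΦ
  refine ⟨(‖(V.symm : H →L[ℂ] SeqL2)‖ + 1)⁻¹, by positivity, fun n => ?_⟩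
  rw [inv_le_iff_one_le_mul₀ (by positivity)]
  have := (V.symm : H →L[ℂ] SeqL2).le_opNorm (Φ n)
  rw [ContinuousLinearEquiv.coe_coe, ← hV, V.symm_apply_apply, norm_unitVec, hV] at this
  nlinarith [norm_nonneg (Φ n)]

lemma IsBesselSeq.smul_of_isNBA {m : ℕ → ℂ} {Ψ : ℕ → H} (hΨ : IsBesselSeq Ψ) (hm : IsNBA m) :
    IsBesselSeq fun n => m n • Ψ n :=
  hΨ.of_norm_le (fun _ => rfl) hm.choose_spec

lemma IsBesselSeq.of_smul_of_isNBB {m : ℕ → ℂ} {Ψ : ℕ → H}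
    (h : IsBesselSeq fun n => m n • Ψ n) (hm : IsNBB m) : IsBesselSeq Ψ := by
  obtain ⟨b, hb⟩ := hm.inv_smul (x := Ψ)
  exact h.of_norm_le (fun n => (hb n).2) fun n => (hb n).1

lemma IsSemiNormalized.isNBB {m : ℕ → ℂ} (hm : IsSemiNormalized m) : IsNBB m := by
  obtain ⟨a, b, ha, h⟩ := hm
  exact ⟨a, ha, fun n => (h n).1⟩

lemma isRieszBasis_smul_iff {m : ℕ → ℂ} {Ψ : ℕ → H} (hm : IsSemiNormalized m) :
    (IsRieszBasis fun n => m n • Ψ n) ↔ IsRieszBasis Ψ := by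
  refine ⟨fun h => ?_, fun h => h.smul hm⟩
  obtain ⟨a, b, ha, hab⟩ := hm
  have hm0 : ∀ n, m n ≠ 0 := fun n => norm_pos_iff.1 (ha.trans_le (hab n).1)
  have hb : 0 < b := ha.trans_le ((hab 0).1.trans (hab 0).2)
  have := h.smul (c := fun n => (m n)⁻¹) ⟨b⁻¹, a⁻¹, by positivity, fun n => by
    rw [norm_inv]
    exact ⟨inv_anti₀ (ha.trans_le (hab n).1) (hab n).2, inv_anti₀ ha (hab n).1⟩⟩
  simpa only [inv_smul_smul₀ (hm0 _)] using this

/-- A weight turning a frame into a Riesz basis is bounded. -/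
lemma IsFrameSeq.isNBA_of_isRieszBasis_smul {m : ℕ → ℂ} {Ψ : ℕ → H} (hΨ : IsFrameSeq Ψ)
    (h : IsRieszBasis fun n => m n • Ψ n) : IsNBA m := by
  obtain ⟨-, A, hA, hlow⟩ := hΨ
  obtain ⟨b, hb⟩ := h.isNBA
  have hm0 : ∀ n, m n ≠ 0 := by
    obtain ⟨a, ha, hn⟩ := h.isNBB
    intro n h0
    have := hn n
    simp only [h0, zero_smul, norm_zero] at this
    linarith
  -- Let `y` be biorthogonal to the Riesz basis at index `k`. Its only nonzero coefficient against
  -- `Ψ` has modulus `1 / ‖m k‖`, so the lower frame bound makes `y` small when `m k` is large; but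
  -- `b * ‖y‖ ≥ 1` by Cauchy–Schwarz.
  have key : ∀ k, A * ‖m k‖ ^ 2 ≤ b ^ 2 := by
    intro k
    obtain ⟨y, hy, -⟩ := (isRieszBasis_iff_moment.1 h).2 (unitVec k)
    have hy' : ∀ n, inner ℂ (Ψ n) y = if n = k then (starRingEnd ℂ (m k))⁻¹ else 0 := by
      intro n
      have h1 := hy n
      have h2 : starRingEnd ℂ (m n) ≠ 0 := by simpa using hm0 n
      rw [inner_smul_left] at h1
      split_ifs with hnk
      · subst hnk
        have h3 : (unitVec n : SeqL2) n = 1 := by simp [unitVec]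
        rw [h3] at h1
        exact eq_inv_of_mul_eq_one_right h1
      · have h3 : (unitVec k : SeqL2) n = 0 := by simp [unitVec, hnk]
        rw [h3] at h1
        exact (mul_eq_zero.1 h1).resolve_left h2
    have hsum : ∑' n, ‖inner ℂ (Ψ n) y‖ ^ 2 = (‖m k‖ ^ 2)⁻¹ := by
      rw [tsum_eq_single k]
      · simp [hy']
      · intro n hn
        simp [hy', hn]
    have hlow' := hlow y
    have hmk : 0 < ‖m k‖ ^ 2 := by have := norm_pos_iff.2 (hm0 k); positivity
    rw [hsum, ← one_div, le_div_iff₀ hmk] at hlow'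
    have hyn : 1 ≤ b ^ 2 * ‖y‖ ^ 2 := by
      have h1 := hy k
      have h3 : (unitVec k : SeqL2) k = 1 := by simp [unitVec]
      have h4 := norm_inner_le_norm (𝕜 := ℂ) (m k • Ψ k) y
      rw [h1, h3, norm_one] at h4
      have h5 : 1 ≤ b * ‖y‖ := h4.trans (mul_le_mul_of_nonneg_right (hb k) (norm_nonneg _))
      rw [← mul_pow]
      exact one_le_pow₀ h5
    calc A * ‖m k‖ ^ 2 ≤ A * ‖m k‖ ^ 2 * (b ^ 2 * ‖y‖ ^ 2) :=
          le_mul_of_one_le_right (by positivity) hyn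
      _ = b ^ 2 * (A * ‖y‖ ^ 2 * ‖m k‖ ^ 2) := by ring
      _ ≤ b ^ 2 := mul_le_of_le_one_right (by positivity) hlow'
  refine ⟨√(b ^ 2 / A), fun n => Real.le_sqrt_of_sq_le ?_⟩
  rw [le_div_iff₀ hA, mul_comm]
  exact key n

end Hilbert

/-! ### Power weights for the examples -/

/-- The weight `(n + 1) ^ a` on even `n` and `(n + 1) ^ b` on odd `n`. -/
def powWeight (a b : ℤ) (n : ℕ) : ℂ :=
  if Even n then ((n : ℂ) + 1) ^ a else ((n : ℂ) + 1) ^ b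

lemma powWeight_ne_zero (a b : ℤ) (n : ℕ) : powWeight a b n ≠ 0 := by
  have : (n : ℂ) + 1 ≠ 0 := Nat.cast_add_one_ne_zero n
  unfold powWeight
  split_ifs <;> exact zpow_ne_zero _ this

lemma powWeight_mul (a b c d : ℤ) (n : ℕ) :
    powWeight a b n * powWeight c d n = powWeight (a + c) (b + d) n := by
  have : (n : ℂ) + 1 ≠ 0 := Nat.cast_add_one_ne_zero n
  unfold powWeight
  split_ifs <;> rw [zpow_add₀ this]

lemma powWeight_inv (a b : ℤ) (n : ℕ) : (powWeight a b n)⁻¹ = powWeight (-a) (-b) n := by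
  unfold powWeight
  split_ifs <;> rw [zpow_neg]

lemma powWeight_zero (n : ℕ) : powWeight 0 0 n = 1 := by
  simp [powWeight]

lemma norm_powWeight (a b : ℤ) (n : ℕ) :
    ‖powWeight a b n‖ = if Even n then ((n : ℝ) + 1) ^ a else ((n : ℝ) + 1) ^ b := by
  have : ‖(n : ℂ) + 1‖ = (n : ℝ) + 1 := by
    rw [← Nat.cast_succ, Complex.norm_natCast, Nat.cast_succ]
  unfold powWeight
  split_ifs <;> rw [norm_zpow, this]

/-- The index map `u` serves to restrict to one parity class. -/
lemma not_forall_zpow_le {a : ℤ} (ha : 0 < a) (u : ℕ → ℕ) (hu : ∀ k, k ≤ u k) (b : ℝ) :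
    ¬ ∀ k, ((u k : ℝ) + 1) ^ a ≤ b := by
  intro h
  obtain ⟨k, hk⟩ := exists_nat_gt b
  have h1 : ((u k : ℝ) + 1) ^ (1 : ℤ) ≤ ((u k : ℝ) + 1) ^ a :=
    zpow_le_zpow_right₀ (by linarith [Nat.cast_nonneg (α := ℝ) (u k)]) (by omega)
  have h2 : (k : ℝ) ≤ u k := Nat.cast_le.2 (hu k)
  rw [zpow_one] at h1
  linarith [h k]

lemma isNBA_powWeight {a b : ℤ} : IsNBA (powWeight a b) ↔ a ≤ 0 ∧ b ≤ 0 := by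
  constructor
  · rintro ⟨B, hB⟩
    constructor
    · by_contra! ha
      refine not_forall_zpow_le ha (fun k => 2 * k) (fun k => by omega) B fun k => ?_
      simpa [norm_powWeight] using hB (2 * k)
    · by_contra! hb
      refine not_forall_zpow_le hb (fun k => 2 * k + 1) (fun k => by omega) B fun k => ?_
      have := hB (2 * k + 1)
      rwa [norm_powWeight, if_neg (by simp)] at this
  · rintro ⟨ha, hb⟩
    refine ⟨1, fun n => ?_⟩
    have h1 : 1 ≤ (n : ℝ) + 1 := by linarith [Nat.cast_nonneg (α := ℝ) n]
    rw [norm_powWeight]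
    split_ifs
    · exact zpow_le_one_of_nonpos₀ h1 ha
    · exact zpow_le_one_of_nonpos₀ h1 hb

lemma isNBB_iff_isNBA_inv {c : ℕ → ℂ} (hc : ∀ n, c n ≠ 0) :
    IsNBB c ↔ IsNBA fun n => (c n)⁻¹ := by
  constructor
  · rintro ⟨a, ha, h⟩
    exact ⟨a⁻¹, fun n => by rw [norm_inv]; exact inv_anti₀ ha (h n)⟩
  · rintro ⟨b, h⟩
    have hb : 0 < b := (norm_pos_iff.2 (inv_ne_zero (hc 0))).trans_le (h 0)
    refine ⟨b⁻¹, by positivity, fun n => ?_⟩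
    have := h n
    rw [norm_inv] at this
    exact inv_le_of_inv_le₀ (norm_pos_iff.2 (hc n)) this

lemma isNBB_powWeight {a b : ℤ} : IsNBB (powWeight a b) ↔ 0 ≤ a ∧ 0 ≤ b := by
  rw [isNBB_iff_isNBA_inv (powWeight_ne_zero a b)]
  simp only [powWeight_inv, isNBA_powWeight, neg_nonpos]

lemma not_summable_powWeight (b : ℤ) : ¬ Summable fun n => ‖powWeight 0 b n‖ ^ 2 := by
  intro h
  have h1 := (h.comp_injective (mul_right_injective₀ (two_ne_zero (α := ℕ)))).tendsto_atTop_zero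
  simp [Function.comp_def, norm_powWeight] at h1

lemma summable_powWeight : Summable fun n => ‖powWeight (-1) (-1) n‖ ^ 2 := by
  have h := (summable_nat_add_iff 1).2 (Real.summable_nat_pow_inv.2 one_lt_two)
  refine h.congr fun n => ?_
  simp [norm_powWeight]

lemma IsNBB.ne_zero {E : Type*} [NormedAddCommGroup E] {x : ℕ → E} (h : IsNBB x) (n : ℕ) :
    x n ≠ 0 := by
  obtain ⟨a, ha, h⟩ := h
  exact norm_pos_iff.1 (ha.trans_le (h n))

lemma IsNBA.comp {E : Type*} [NormedAddCommGroup E] {x : ℕ → E} (hx : IsNBA x) (u : ℕ → ℕ) :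
    IsNBA fun n => x (u n) :=
  ⟨hx.choose, fun n => hx.choose_spec (u n)⟩

lemma IsNBB.comp {E : Type*} [NormedAddCommGroup E] {x : ℕ → E} (hx : IsNBB x) (u : ℕ → ℕ) :
    IsNBB fun n => x (u n) :=
  ⟨hx.choose, hx.choose_spec.1, fun n => hx.choose_spec.2 (u n)⟩

section Norm

variable {E : Type*} [NormedAddCommGroup E] [NormedSpace ℂ E]

lemma isNBA_smul_iff {c : ℕ → ℂ} {x : ℕ → E} (hx : IsNBA x) (hx' : IsNBB x) :
    (IsNBA fun n => c n • x n) ↔ IsNBA c := by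
  refine ⟨fun h => h.of_smul_right hx', fun h => ?_⟩
  obtain ⟨b, hb⟩ := hx
  refine h.of_norm_le_mul (b := b) fun n => ?_
  rw [norm_smul, mul_comm]
  exact mul_le_mul_of_nonneg_right (hb n) (norm_nonneg _)

lemma isNBB_smul_iff {c : ℕ → ℂ} {x : ℕ → E} (hx : IsNBA x) (hx' : IsNBB x) :
    (IsNBB fun n => c n • x n) ↔ IsNBB c := by
  refine ⟨fun h => h.of_smul_right hx, fun ⟨a, ha, h⟩ => ?_⟩
  obtain ⟨b, hb, hx'⟩ := hx'
  refine ⟨a * b, by positivity, fun n => ?_⟩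
  rw [norm_smul]
  exact mul_le_mul (h n) (hx' n) hb.le (norm_nonneg _)

end Norm

/-! ### Weighted Riesz bases, constant sequences and doubled bases -/

section Hilbert

variable {H : Type*} [NormedAddCommGroup H] [InnerProductSpace ℂ H]

variable [CompleteSpace H]

lemma IsRieszBasis.powWeight_smul_ne_zero {Φ : ℕ → H} (hΦ : IsRieszBasis Φ)
    {a b : ℤ} (n : ℕ) : powWeight a b n • Φ n ≠ 0 :=
  smul_ne_zero (powWeight_ne_zero a b n) (hΦ.isNBB.ne_zero n)

lemma IsRieszBasis.isNBA_powWeight_smul {Φ : ℕ → H} (hΦ : IsRieszBasis Φ)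
    {a b : ℤ} :
    (IsNBA fun n => powWeight a b n • Φ n) ↔ a ≤ 0 ∧ b ≤ 0 := by
  rw [isNBA_smul_iff hΦ.isNBA hΦ.isNBB, isNBA_powWeight]

lemma IsRieszBasis.isNBB_powWeight_smul {Φ : ℕ → H} (hΦ : IsRieszBasis Φ)
    {a b : ℤ} :
    (IsNBB fun n => powWeight a b n • Φ n) ↔ 0 ≤ a ∧ 0 ≤ b := by
  rw [isNBB_smul_iff hΦ.isNBA hΦ.isNBB, isNBB_powWeight]

/-- For weighted Riesz bases, Bessel and norm-bounded coincide. -/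
lemma IsRieszBasis.isBesselSeq_powWeight_smul {Φ : ℕ → H} (hΦ : IsRieszBasis Φ)
    {a b : ℤ} :
    (IsBesselSeq fun n => powWeight a b n • Φ n) ↔ a ≤ 0 ∧ b ≤ 0 := by
  refine ⟨fun h => hΦ.isNBA_powWeight_smul.1 h.isNBA, fun h => ?_⟩
  exact hΦ.isBesselSeq.smul_of_isNBA (isNBA_powWeight.2 h)

lemma IsRieszBasis.isRieszBasis_powWeight_smul {Φ : ℕ → H} (hΦ : IsRieszBasis Φ)
    {a b : ℤ} :
    (IsRieszBasis fun n => powWeight a b n • Φ n) ↔ a = 0 ∧ b = 0 := by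
  constructor
  · intro h
    have h1 := hΦ.isNBA_powWeight_smul.1 h.isNBA
    have h2 := hΦ.isNBB_powWeight_smul.1 h.isNBB
    omega
  · rintro ⟨rfl, rfl⟩
    simpa only [powWeight_zero, one_smul] using hΦ

lemma IsRieszBasis.isFrameSeq {Φ : ℕ → H} (hΦ : IsRieszBasis Φ) : IsFrameSeq Φ := by
  refine ⟨hΦ.isBesselSeq, ?_⟩
  obtain ⟨V, R, hV, -, -, hRV, -⟩ := hΦ.exists_canonicalDual
  refine ⟨(‖R‖ ^ 2 + 1)⁻¹, by positivity, fun h => ?_⟩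
  have h1 := R.le_opNorm (ContinuousLinearMap.adjoint V h)
  rw [hRV] at h1
  have h2 := pow_le_pow_left₀ (norm_nonneg _) h1 2
  rw [mul_pow, seqL2_norm_sq] at h2
  simp only [adjoint_apply_eq_inner hV] at h2
  have h3 : 0 ≤ ∑' n, ‖inner ℂ (Φ n) h‖ ^ 2 := tsum_nonneg fun _ => by positivity
  rw [inv_mul_le_iff₀ (by positivity)]
  linarith

lemma IsRieszBasis.isFrameSeq_powWeight_smul {Φ : ℕ → H} (hΦ : IsRieszBasis Φ) {a b : ℤ} :
    (IsFrameSeq fun n => powWeight a b n • Φ n) ↔ a = 0 ∧ b = 0 := by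
  refine ⟨fun h => ?_, fun h => (hΦ.isRieszBasis_powWeight_smul.2 h).isFrameSeq⟩
  -- The inverse weight turns the frame back into `Φ`, so it is bounded and the exponents are
  -- nonnegative; the Bessel property makes them nonpositive.
  have h1 : IsRieszBasis fun n => powWeight (-a) (-b) n • powWeight a b n • Φ n := by
    simpa only [smul_smul, powWeight_mul, neg_add_cancel, powWeight_zero, one_smul] using hΦ
  have h2 := isNBA_powWeight.1 (h.isNBA_of_isRieszBasis_smul h1)
  have h3 := hΦ.isBesselSeq_powWeight_smul.1 h.1
  omega

lemma IsRieszBasis.multiplierWellDefined_left_powWeight {Φ : ℕ → H} (hΦ : IsRieszBasis Φ)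
    {a b c d : ℤ} :
    MultiplierWellDefined (powWeight a b) Φ (fun n => powWeight c d n • Φ n) ↔
      a + c ≤ 0 ∧ b + d ≤ 0 := by
  rw [multiplierWellDefined_left_iff hΦ]
  simp only [smul_smul, powWeight_mul, hΦ.isBesselSeq_powWeight_smul]

lemma IsRieszBasis.multiplierWellDefined_right_powWeight {Φ : ℕ → H} (hΦ : IsRieszBasis Φ)
    {a b c d : ℤ} :
    MultiplierWellDefined (powWeight a b) (fun n => powWeight c d n • Φ n) Φ ↔
      a + c ≤ 0 ∧ b + d ≤ 0 := by
  rw [multiplierWellDefined_right_iff hΦ]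
  simp only [smul_smul, powWeight_mul, hΦ.isBesselSeq_powWeight_smul]

lemma IsRieszBasis.multiplierInvertible_left_powWeight {Φ : ℕ → H} (hΦ : IsRieszBasis Φ)
    {a b c d : ℤ} :
    MultiplierInvertible (powWeight a b) Φ (fun n => powWeight c d n • Φ n) ↔
      a + c = 0 ∧ b + d = 0 := by
  rw [multiplierInvertible_left_iff hΦ]
  simp only [smul_smul, powWeight_mul, hΦ.isRieszBasis_powWeight_smul]

lemma IsRieszBasis.multiplierInvertible_right_powWeight {Φ : ℕ → H} (hΦ : IsRieszBasis Φ)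
    {a b c d : ℤ} :
    MultiplierInvertible (powWeight a b) (fun n => powWeight c d n • Φ n) Φ ↔
      a + c = 0 ∧ b + d = 0 := by
  rw [multiplierInvertible_right_iff hΦ]
  simp only [smul_smul, powWeight_mul, hΦ.isRieszBasis_powWeight_smul]

/-- Testing on `x` itself gives necessity. -/
lemma isBesselSeq_smul_const {x : H} (hx : x ≠ 0) {c : ℕ → ℂ} :
    (IsBesselSeq fun n => c n • x) ↔ Summable fun n => ‖c n‖ ^ 2 := by
  rw [isBesselSeq_smul_iff]
  simp only [norm_mul, mul_pow]
  refine ⟨fun h => ?_, fun h f => h.mul_right _⟩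
  have h1 := h x
  rwa [summable_mul_right_iff] at h1
  simpa using hx

lemma IsBesselSeq.comp_div_two {Φ : ℕ → H} (hΦ : IsBesselSeq Φ) :
    IsBesselSeq fun n => Φ (n / 2) := by
  rw [isBesselSeq_iff_summable] at hΦ ⊢
  intro h
  obtain ⟨s, hs⟩ := hΦ h
  refine (HasSum.even_add_odd (m := s) (m' := s) ?_ ?_).summable
  · simpa using hs
  · have : ∀ k, (2 * k + 1) / 2 = k := fun k => by omega
    simpa only [this] using hs

/-- The even indices carry an unweighted copy of `Φ`, which already secures the lower frame bound;
the odd copy may then decay. For `b < 0` this gives frames that are not bounded below. -/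
lemma IsRieszBasis.isFrameSeq_powWeight_div_two {Φ : ℕ → H} (hΦ : IsRieszBasis Φ) {b : ℤ}
    (hb : b ≤ 0) : IsFrameSeq fun n => powWeight 0 b n • Φ (n / 2) := by
  have hB : IsBesselSeq fun n => powWeight 0 b n • Φ (n / 2) :=
    hΦ.isBesselSeq.comp_div_two.smul_of_isNBA (isNBA_powWeight.2 ⟨le_rfl, hb⟩)
  refine ⟨hB, ?_⟩
  obtain ⟨-, A, hA, hlow⟩ := hΦ.isFrameSeq
  refine ⟨A, hA, fun h => (hlow h).trans ?_⟩
  refine le_trans (le_of_eq ?_) (tsum_comp_le_tsum_of_inj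
    (isBesselSeq_iff_summable.1 hB h) (fun _ => by positivity)
    (mul_right_injective₀ (two_ne_zero (α := ℕ))))
  refine tsum_congr fun k => ?_
  simp [powWeight]

end Hilbert

end

/-! ### Assembly of the cases -/

theorem theorem4 {H : Type*} [NormedAddCommGroup H] [InnerProductSpace ℂ H] [CompleteSpace H]
    (Φ : ℕ → H) (hΦ : IsRieszBasis Φ) :
    -- (a) `m` semi-normalized
    -- (a1)
    (∀ (m : ℕ → ℂ) (Ψ : ℕ → H), IsSemiNormalized m → ¬ IsBesselSeq Ψ →
      ¬ MultiplierWellDefined m Φ Ψ ∧ ¬ MultiplierWellDefined m Ψ Φ) ∧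
    -- (a2)
    (∀ (m : ℕ → ℂ) (Ψ : ℕ → H), IsSemiNormalized m → IsBesselSeq Ψ →
      (MultiplierInvertible m Φ Ψ ↔ IsRieszBasis Ψ) ∧
      (MultiplierInvertible m Ψ Φ ↔ IsRieszBasis Ψ) ∧
      (MultiplierInvertible m Φ Ψ →
        MultiplierWellDefined (fun n => 1 / m n) (canonicalDual Ψ) (canonicalDual Φ) ∧
        Function.LeftInverse
          (multiplier (fun n => 1 / m n) (canonicalDual Ψ) (canonicalDual Φ))
          (multiplier m Φ Ψ) ∧
        Function.RightInverse
          (multiplier (fun n => 1 / m n) (canonicalDual Ψ) (canonicalDual Φ))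
          (multiplier m Φ Ψ))) ∧
    -- (b) `m` non-NBB and bounded
    -- (b1) `Ψ` NBA non-Bessel
    ((∀ (m : ℕ → ℂ) (Ψ : ℕ → H), ¬ IsNBB m → Memℓp m ∞ → IsNBA Ψ → ¬ IsBesselSeq Ψ →
        ¬ MultiplierInvertible m Φ Ψ ∧ ¬ MultiplierInvertible m Ψ Φ) ∧
      (∃ (m : ℕ → ℂ) (Ψ : ℕ → H), (∀ n, m n ≠ 0) ∧ (∀ n, Ψ n ≠ 0) ∧
        ¬ IsNBB m ∧ Memℓp m ∞ ∧ IsNBA Ψ ∧ ¬ IsBesselSeq Ψ ∧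
        MultiplierWellDefined m Φ Ψ ∧ MultiplierWellDefined m Ψ Φ) ∧
      (∃ (m : ℕ → ℂ) (Ψ : ℕ → H), (∀ n, m n ≠ 0) ∧ (∀ n, Ψ n ≠ 0) ∧
        ¬ IsNBB m ∧ Memℓp m ∞ ∧ IsNBA Ψ ∧ ¬ IsBesselSeq Ψ ∧
        ¬ MultiplierWellDefined m Φ Ψ ∧ ¬ MultiplierWellDefined m Ψ Φ)) ∧
    -- (b2) `Ψ` non-NBA, non-NBB, non-Bessel
    ((∀ (m : ℕ → ℂ) (Ψ : ℕ → H), ¬ IsNBB m → Memℓp m ∞ →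
        ¬ IsNBA Ψ → ¬ IsNBB Ψ → ¬ IsBesselSeq Ψ →
        ¬ MultiplierInvertible m Φ Ψ ∧ ¬ MultiplierInvertible m Ψ Φ) ∧
      (∃ (m : ℕ → ℂ) (Ψ : ℕ → H), (∀ n, m n ≠ 0) ∧ (∀ n, Ψ n ≠ 0) ∧
        ¬ IsNBB m ∧ Memℓp m ∞ ∧ ¬ IsNBA Ψ ∧ ¬ IsNBB Ψ ∧ ¬ IsBesselSeq Ψ ∧
        MultiplierWellDefined m Φ Ψ ∧ MultiplierWellDefined m Ψ Φ) ∧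
      (∃ (m : ℕ → ℂ) (Ψ : ℕ → H), (∀ n, m n ≠ 0) ∧ (∀ n, Ψ n ≠ 0) ∧
        ¬ IsNBB m ∧ Memℓp m ∞ ∧ ¬ IsNBA Ψ ∧ ¬ IsNBB Ψ ∧ ¬ IsBesselSeq Ψ ∧
        ¬ MultiplierWellDefined m Φ Ψ ∧ ¬ MultiplierWellDefined m Ψ Φ)) ∧
    -- (b3) `Ψ` non-NBA, NBB, non-Bessel
    ((∃ (m : ℕ → ℂ) (Ψ : ℕ → H), (∀ n, m n ≠ 0) ∧ (∀ n, Ψ n ≠ 0) ∧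
        ¬ IsNBB m ∧ Memℓp m ∞ ∧ ¬ IsNBA Ψ ∧ IsNBB Ψ ∧ ¬ IsBesselSeq Ψ ∧
        MultiplierInvertible m Φ Ψ ∧ MultiplierInvertible m Ψ Φ) ∧
      (∃ (m : ℕ → ℂ) (Ψ : ℕ → H), (∀ n, m n ≠ 0) ∧ (∀ n, Ψ n ≠ 0) ∧
        ¬ IsNBB m ∧ Memℓp m ∞ ∧ ¬ IsNBA Ψ ∧ IsNBB Ψ ∧ ¬ IsBesselSeq Ψ ∧
        MultiplierWellDefined m Φ Ψ ∧ MultiplierWellDefined m Ψ Φ ∧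
        ¬ MultiplierInvertible m Φ Ψ ∧ ¬ MultiplierInvertible m Ψ Φ) ∧
      (∃ (m : ℕ → ℂ) (Ψ : ℕ → H), (∀ n, m n ≠ 0) ∧ (∀ n, Ψ n ≠ 0) ∧
        ¬ IsNBB m ∧ Memℓp m ∞ ∧ ¬ IsNBA Ψ ∧ IsNBB Ψ ∧ ¬ IsBesselSeq Ψ ∧
        ¬ MultiplierWellDefined m Φ Ψ ∧ ¬ MultiplierWellDefined m Ψ Φ)) ∧
    -- (b4) `Ψ` Bessel
    (∀ (m : ℕ → ℂ) (Ψ : ℕ → H), ¬ IsNBB m → Memℓp m ∞ → IsBesselSeq Ψ →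
      MultiplierWellDefined m Φ Ψ ∧ MultiplierWellDefined m Ψ Φ ∧
      ¬ MultiplierInvertible m Φ Ψ ∧ ¬ MultiplierInvertible m Ψ Φ) ∧
    -- (c) `m` NBB and unbounded
    -- (c1) `Ψ` non-Bessel or NBB
    (∀ (m : ℕ → ℂ) (Ψ : ℕ → H), IsNBB m → ¬ Memℓp m ∞ → (¬ IsBesselSeq Ψ ∨ IsNBB Ψ) →
      ¬ MultiplierWellDefined m Φ Ψ ∧ ¬ MultiplierWellDefined m Ψ Φ) ∧
    -- (c2) `Ψ` non-NBB, Bessel, not a frame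
    ((∃ (m : ℕ → ℂ) (Ψ : ℕ → H), (∀ n, m n ≠ 0) ∧ (∀ n, Ψ n ≠ 0) ∧
        IsNBB m ∧ ¬ Memℓp m ∞ ∧ ¬ IsNBB Ψ ∧ IsBesselSeq Ψ ∧ ¬ IsFrameSeq Ψ ∧
        MultiplierInvertible m Φ Ψ ∧ MultiplierInvertible m Ψ Φ) ∧
      (∃ (m : ℕ → ℂ) (Ψ : ℕ → H), (∀ n, m n ≠ 0) ∧ (∀ n, Ψ n ≠ 0) ∧
        IsNBB m ∧ ¬ Memℓp m ∞ ∧ ¬ IsNBB Ψ ∧ IsBesselSeq Ψ ∧ ¬ IsFrameSeq Ψ ∧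
        MultiplierWellDefined m Φ Ψ ∧ MultiplierWellDefined m Ψ Φ ∧
        ¬ MultiplierInvertible m Φ Ψ ∧ ¬ MultiplierInvertible m Ψ Φ) ∧
      (∃ (m : ℕ → ℂ) (Ψ : ℕ → H), (∀ n, m n ≠ 0) ∧ (∀ n, Ψ n ≠ 0) ∧
        IsNBB m ∧ ¬ Memℓp m ∞ ∧ ¬ IsNBB Ψ ∧ IsBesselSeq Ψ ∧ ¬ IsFrameSeq Ψ ∧
        ¬ MultiplierWellDefined m Φ Ψ ∧ ¬ MultiplierWellDefined m Ψ Φ)) ∧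
    -- (c3) `Ψ` a non-NBB frame
    ((∀ (m : ℕ → ℂ) (Ψ : ℕ → H), IsNBB m → ¬ Memℓp m ∞ → ¬ IsNBB Ψ → IsFrameSeq Ψ →
        ¬ MultiplierInvertible m Φ Ψ ∧ ¬ MultiplierInvertible m Ψ Φ) ∧
      (∃ (m : ℕ → ℂ) (Ψ : ℕ → H), (∀ n, m n ≠ 0) ∧ (∀ n, Ψ n ≠ 0) ∧
        IsNBB m ∧ ¬ Memℓp m ∞ ∧ ¬ IsNBB Ψ ∧ IsFrameSeq Ψ ∧
        MultiplierWellDefined m Φ Ψ ∧ MultiplierWellDefined m Ψ Φ) ∧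
      (∃ (m : ℕ → ℂ) (Ψ : ℕ → H), (∀ n, m n ≠ 0) ∧ (∀ n, Ψ n ≠ 0) ∧
        IsNBB m ∧ ¬ Memℓp m ∞ ∧ ¬ IsNBB Ψ ∧ IsFrameSeq Ψ ∧
        ¬ MultiplierWellDefined m Φ Ψ ∧ ¬ MultiplierWellDefined m Ψ Φ)) ∧
    -- (d) `m` non-NBB and unbounded
    -- (d1) `Ψ` NBB
    (∀ (m : ℕ → ℂ) (Ψ : ℕ → H), ¬ IsNBB m → ¬ Memℓp m ∞ → IsNBB Ψ →
      ¬ MultiplierWellDefined m Φ Ψ ∧ ¬ MultiplierWellDefined m Ψ Φ) ∧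
    -- (d2) `Ψ` non-NBB, non-NBA, non-Bessel
    ((∃ (m : ℕ → ℂ) (Ψ : ℕ → H), (∀ n, m n ≠ 0) ∧ (∀ n, Ψ n ≠ 0) ∧
        ¬ IsNBB m ∧ ¬ Memℓp m ∞ ∧ ¬ IsNBB Ψ ∧ ¬ IsNBA Ψ ∧ ¬ IsBesselSeq Ψ ∧
        MultiplierInvertible m Φ Ψ ∧ MultiplierInvertible m Ψ Φ) ∧
      (∃ (m : ℕ → ℂ) (Ψ : ℕ → H), (∀ n, m n ≠ 0) ∧ (∀ n, Ψ n ≠ 0) ∧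
        ¬ IsNBB m ∧ ¬ Memℓp m ∞ ∧ ¬ IsNBB Ψ ∧ ¬ IsNBA Ψ ∧ ¬ IsBesselSeq Ψ ∧
        MultiplierWellDefined m Φ Ψ ∧ MultiplierWellDefined m Ψ Φ ∧
        ¬ MultiplierInvertible m Φ Ψ ∧ ¬ MultiplierInvertible m Ψ Φ) ∧
      (∃ (m : ℕ → ℂ) (Ψ : ℕ → H), (∀ n, m n ≠ 0) ∧ (∀ n, Ψ n ≠ 0) ∧
        ¬ IsNBB m ∧ ¬ Memℓp m ∞ ∧ ¬ IsNBB Ψ ∧ ¬ IsNBA Ψ ∧ ¬ IsBesselSeq Ψ ∧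
        ¬ MultiplierWellDefined m Φ Ψ ∧ ¬ MultiplierWellDefined m Ψ Φ)) ∧
    -- (d3) `Ψ` non-NBB and NBA
    ((∀ (m : ℕ → ℂ) (Ψ : ℕ → H), ¬ IsNBB m → ¬ Memℓp m ∞ → ¬ IsNBB Ψ → IsNBA Ψ →
        ¬ MultiplierInvertible m Φ Ψ ∧ ¬ MultiplierInvertible m Ψ Φ) ∧
      (∃ (m : ℕ → ℂ) (Ψ : ℕ → H), (∀ n, m n ≠ 0) ∧ (∀ n, Ψ n ≠ 0) ∧
        ¬ IsNBB m ∧ ¬ Memℓp m ∞ ∧ ¬ IsNBB Ψ ∧ IsNBA Ψ ∧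
        MultiplierWellDefined m Φ Ψ ∧ MultiplierWellDefined m Ψ Φ) ∧
      (∃ (m : ℕ → ℂ) (Ψ : ℕ → H), (∀ n, m n ≠ 0) ∧ (∀ n, Ψ n ≠ 0) ∧
        ¬ IsNBB m ∧ ¬ Memℓp m ∞ ∧ ¬ IsNBB Ψ ∧ IsNBA Ψ ∧
        ¬ MultiplierWellDefined m Φ Ψ ∧ ¬ MultiplierWellDefined m Ψ Φ)) := by
  have hA := hΦ.isNBA
  have hB := hΦ.isNBB
  have hΦ0 := hB.ne_zero
  simp only [memℓp_top_iff]
  have notWD : ∀ {m : ℕ → ℂ} {Ψ : ℕ → H}, (¬ IsBesselSeq fun n => m n • Ψ n) →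
      ¬ MultiplierWellDefined m Φ Ψ ∧ ¬ MultiplierWellDefined m Ψ Φ := fun h =>
    ⟨fun hw => h ((multiplierWellDefined_left_iff hΦ).1 hw),
      fun hw => h ((multiplierWellDefined_right_iff hΦ).1 hw)⟩
  have wd : ∀ {m : ℕ → ℂ} {Ψ : ℕ → H}, (IsBesselSeq fun n => m n • Ψ n) →
      MultiplierWellDefined m Φ Ψ ∧ MultiplierWellDefined m Ψ Φ := fun h =>
    ⟨(multiplierWellDefined_left_iff hΦ).2 h, (multiplierWellDefined_right_iff hΦ).2 h⟩
  have notInv : ∀ {m : ℕ → ℂ} {Ψ : ℕ → H}, (¬ IsRieszBasis fun n => m n • Ψ n) →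
      ¬ MultiplierInvertible m Φ Ψ ∧ ¬ MultiplierInvertible m Ψ Φ := fun h =>
    ⟨fun hw => h ((multiplierInvertible_left_iff hΦ).1 hw),
      fun hw => h ((multiplierInvertible_right_iff hΦ).1 hw)⟩
  have diag : ∀ (a b c d : ℤ) {P : (ℕ → ℂ) → (ℕ → H) → Prop},
      P (powWeight a b) (fun n => powWeight c d n • Φ n) →
      ∃ (m : ℕ → ℂ) (Ψ : ℕ → H), (∀ n, m n ≠ 0) ∧ (∀ n, Ψ n ≠ 0) ∧ P m Ψ :=
    fun a b c d P hP => ⟨_, _, powWeight_ne_zero a b, hΦ.powWeight_smul_ne_zero, hP⟩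
  have hconst : ¬ IsBesselSeq fun _ : ℕ => Φ 0 := by
    have h := (isBesselSeq_smul_const (hΦ0 0) (c := powWeight 0 0)).not.2 (not_summable_powWeight 0)
    simpa only [powWeight_zero, one_smul] using h
  have hfold0 : ∀ n, powWeight 0 (-1) n • Φ (n / 2) ≠ 0 := fun n =>
    smul_ne_zero (powWeight_ne_zero _ _ n) (hΦ0 _)
  have hfoldNBB : ∀ a b : ℤ, (IsNBB fun n => powWeight a b n • Φ (n / 2)) ↔ 0 ≤ a ∧ 0 ≤ b :=
    fun a b => by rw [isNBB_smul_iff (hA.comp (· / 2)) (hB.comp (· / 2)), isNBB_powWeight]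
  have hfoldNBA : ∀ a b : ℤ, (IsNBA fun n => powWeight a b n • Φ (n / 2)) ↔ a ≤ 0 ∧ b ≤ 0 :=
    fun a b => by rw [isNBA_smul_iff (hA.comp (· / 2)) (hB.comp (· / 2)), isNBA_powWeight]
  -- In `diag a b c d`, `m` has exponents `a, b` and `Ψ` has `c, d` (even, odd). Both multipliers
  -- are invertible when `a + c` and `b + d` vanish, and well defined when neither is positive.
  refine ⟨?a1, ?a2, ⟨?b1, ?b1e, ?b1f⟩, ⟨?b2, diag (-1) (-1) 1 (-1) ?b2e, diag (-1) (-1) 2 (-1) ?b2f⟩,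
    ⟨diag (-1) (-1) 1 1 ?b3, diag (-2) (-2) 1 1 ?b3e, diag (-1) (-1) 2 2 ?b3f⟩, ?b4, ?c1,
    ⟨diag 1 1 (-1) (-1) ?c2, diag 1 1 (-2) (-2) ?c2e, diag 2 2 (-1) (-1) ?c2f⟩,
    ⟨?c3, ?c3e, ?c3f⟩, ?d1,
    ⟨diag (-1) 1 1 (-1) ?d2, diag (-1) 1 1 (-2) ?d2e, diag (-1) 1 2 (-1) ?d2f⟩,
    ⟨?d3, diag 1 (-1) (-1) (-1) ?d3e, diag 2 (-1) (-1) (-1) ?d3f⟩⟩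
  case a1 => exact fun m Ψ hm hΨ => notWD fun h => hΨ (h.of_smul_of_isNBB hm.isNBB)
  case a2 =>
    intro m Ψ hm _
    have hl := (multiplierInvertible_left_iff (m := m) (Ψ := Ψ) hΦ).trans (isRieszBasis_smul_iff hm)
    exact ⟨hl, (multiplierInvertible_right_iff hΦ).trans (isRieszBasis_smul_iff hm),
      fun h => multiplier_inverse hm hΦ (hl.1 h)⟩
  case b1 => exact fun m Ψ hm _ hΨ _ => notInv fun h => hm (h.isNBB.of_smul_right hΨ)
  case b2 => exact fun m Ψ _ hm _ hΨ _ => notInv fun h => hΨ (h.isNBB.of_smul_left hm)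
  case b4 =>
    intro m Ψ hm hm' hΨ
    have hw := wd (hΨ.smul_of_isNBA hm')
    exact ⟨hw.1, hw.2, notInv fun h => hm (h.isNBB.of_smul_right hΨ.isNBA)⟩
  case c1 =>
    rintro m Ψ hm hm' (hΨ | hΨ)
    · exact notWD fun h => hΨ (h.of_smul_of_isNBB hm)
    · exact notWD fun h => hm' (h.isNBA.of_smul_right hΨ)
  case c3 => exact fun m Ψ _ hm' _ hΨ => notInv fun h => hm' (hΨ.isNBA_of_isRieszBasis_smul h)
  case d1 => exact fun m Ψ _ hm' hΨ => notWD fun h => hm' (h.isNBA.of_smul_right hΨ)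
  case d3 => exact fun m Ψ hm _ _ hΨ => notInv fun h => hm (h.isNBB.of_smul_right hΨ)
  case b1e =>
    refine ⟨powWeight (-1) (-1), fun _ => Φ 0, powWeight_ne_zero _ _, fun _ => hΦ0 0,
      by simp [isNBB_powWeight], by simp [isNBA_powWeight], hA.comp fun _ => 0, hconst, ?_⟩
    exact wd ((isBesselSeq_smul_const (hΦ0 0)).2 summable_powWeight)
  case b1f =>
    -- Here `m` is 1 on even indices, hence not square summable, yet tends to zero along odd ones.
    refine ⟨powWeight 0 (-1), fun _ => Φ 0, powWeight_ne_zero _ _, fun _ => hΦ0 0,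
      by simp [isNBB_powWeight], by simp [isNBA_powWeight], hA.comp fun _ => 0, hconst, ?_⟩
    exact notWD ((isBesselSeq_smul_const (hΦ0 0)).not.2 (not_summable_powWeight _))
  case c3e =>
    -- Redundancy is needed: a power-weighted `Φ` that is a frame has zero exponents, so is bounded
    -- below. Here `mΨ` is `Φ` with every vector taken twice.
    refine ⟨powWeight 0 1, fun n => powWeight 0 (-1) n • Φ (n / 2), powWeight_ne_zero _ _, hfold0,
      by simp [isNBB_powWeight], by simp [isNBA_powWeight], by simp [hfoldNBB],
      hΦ.isFrameSeq_powWeight_div_two (by simp), wd ?_⟩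
    simpa [smul_smul, powWeight_mul, powWeight_zero] using hΦ.isBesselSeq.comp_div_two
  case c3f =>
    refine ⟨powWeight 0 2, fun n => powWeight 0 (-1) n • Φ (n / 2), powWeight_ne_zero _ _, hfold0,
      by simp [isNBB_powWeight], by simp [isNBA_powWeight], by simp [hfoldNBB],
      hΦ.isFrameSeq_powWeight_div_two (by simp), notWD fun h => ?_⟩
    have := h.isNBA
    simp [smul_smul, powWeight_mul, hfoldNBA] at this
  -- The remaining goals are the power-weight examples, which reduce to decidable comparisons of
  -- integer exponents.
  all_goals
    simp +decide only [isNBA_powWeight, isNBB_powWeight, hΦ.isNBA_powWeight_smul,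
      hΦ.isFrameSeq_powWeight_smul, hΦ.isNBB_powWeight_smul, hΦ.isBesselSeq_powWeight_smul,
      hΦ.multiplierWellDefined_left_powWeight, hΦ.multiplierWellDefined_right_powWeight,
      hΦ.multiplierInvertible_left_powWeight, hΦ.multiplierInvertible_right_powWeight]
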